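/- Let $\mathcal A[\mathbb R^2]$ be the Weyl algebra, i.e. the (unique up to isomorphism) nonzero $C^*$-algebra generated by two one-parameter groups of unitaries $\{U_a\}_{a\in\mathbb R}$ and $\{V_b\}_{b\in\mathbb R}$ (no continuity in $a$, $b$ is assumed) satisfying $U_aV_b=e^{-iab}V_bU_a$ for all $a,b\in\mathbb R$. For $a\in\mathbb R$ let $u_a(x)=e^{iax}$ $(x\in\mathbb R)$, let $AP(\mathbb R)$ be the $C^*$-subalgebra of the bounded continuous functions $\mathbb R\to\mathbb C$ generated by $\{u_a : a\in\mathbb R\}$, and let the Bohr compactification $b\mathbb R$ be the (compact Hausdorff) space of characters of $AP(\mathbb R)$ with the weak* topology and its Borel $\sigma$-algebra $\Sigma(b\mathbb R)$; we write $u_a$ also for the continuous function on $b\mathbb R$ that corresponds to $u_a$ under $AP(\mathbb R)\cong C(b\mathbb R)$, that is, $u_a(\lambda)=\lambda(u_a)$ for $\lambda\in b\mathbb R$. Then for every irreducible (unital $*$-) representation $\pi$ of $\mathcal A[\mathbb R^2]$ on a complex Hilbert space $H\neq 0$ (irreducible: no closed subspaces other than $0$ and $H$ are invariant under $\pi(\mathcal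 A[\mathbb R^2])$) there is a pair $(E^Q,E^P)$ of projection-valued measures on $b\mathbb R$, acting on $H$, such that $$\pi(U_a)=\int_{b\mathbb R}u_a(\lambda)\,dE^Q_\lambda,\qquad \pi(V_b)=\int_{b\mathbb R}u_b(\lambda)\,dE^P_\lambda\qquad\text{for all }a,b\in\mathbb R .$$ Here a projection-valued measure $E$ on $b\mathbb R$ assigns to each Borel set $S$ an orthogonal projection $E(S)$ on $H$, with $E(\emptyset)=0$, $E(b\mathbb R)=I$, $E(S\cap T)=E(S)E(T)$ and $E(\bigcup_n S_n)\varphi=\sum_n E(S_n)\varphi$ for pairwise disjoint $S_n$ and $\varphi\in H$; and $T=\int f\,dE$ means that for every $\varphi\in H$ one has $\langle\varphi,T\varphi\rangle=\int_{b\mathbb R} f\,d\mu_\varphi$, the integral existing, where $\mu_\varphi$ is the measure $\mu_\varphi(S)=\langle\varphi,E(S)\varphi\rangle$ on $\Sigma(b\mathbb R)$. -/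

import Mathlib

open MeasureTheory
open scoped ENNReal BoundedContinuousFunction InnerProductSpace

noncomputable section

/-! ### Almost periodic functions and the Bohr compactification -/

/-- The bounded continuous function `u_a : ℝ → ℂ`, `u_a x = exp (i a x)`. -/
def expFun (a : ℝ) : ℝ →ᵇ ℂ :=
  BoundedContinuousFunction.ofNormedAddCommGroup
    (fun x : ℝ => Complex.exp (Complex.I * a * x)) (by fun_prop) 1 (fun x => by
      have h : Complex.I * a * x = ((a * x : ℝ) : ℂ) * Complex.I := by push_cast; ring
      rw [h, Complex.norm_exp_ofReal_mul_I])

/-- `AP(ℝ)`: the C⋆-subalgebra of the bounded continuous functions on `ℝ` generated by the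
functions `u_a`, `a ∈ ℝ`. -/
def almostPeriodic : StarSubalgebra ℂ (ℝ →ᵇ ℂ) :=
  (StarAlgebra.adjoin ℂ (Set.range expFun)).topologicalClosure

instance isClosed_almostPeriodic : IsClosed (almostPeriodic : Set (ℝ →ᵇ ℂ)) :=
  StarSubalgebra.isClosed_topologicalClosure _

/-- `u_a` as an element of `AP(ℝ)`. -/
def apExp (a : ℝ) : almostPeriodic :=
  ⟨expFun a, StarSubalgebra.le_topologicalClosure _
    (StarAlgebra.subset_adjoin ℂ _ (Set.mem_range_self a))⟩

/-- The Bohr compactification `bℝ`: the space of pure states (that is, characters) of the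
commutative C⋆-algebra `AP(ℝ)`, with the weak-⋆ topology. -/
def BohrCompactification : Type :=
  WeakDual.characterSpace ℂ almostPeriodic

namespace BohrCompactification

instance : TopologicalSpace BohrCompactification :=
  inferInstanceAs (TopologicalSpace (WeakDual.characterSpace ℂ almostPeriodic))

instance : CompactSpace BohrCompactification :=
  inferInstanceAs (CompactSpace (WeakDual.characterSpace ℂ almostPeriodic))

instance : T2Space BohrCompactification :=
  inferInstanceAs (T2Space (WeakDual.characterSpace ℂ almostPeriodic))

/-- `bℝ` carries its Borel σ-algebra. -/
instance : MeasurableSpace BohrCompactification := borel BohrCompactification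

instance : BorelSpace BohrCompactification := ⟨rfl⟩

/-- The isomorphism of `AP(ℝ)` with `C(bℝ)`: the element `f` of `AP(ℝ)` becomes the function
`χ ↦ χ f` on `bℝ`. -/
def extend (f : almostPeriodic) : C(BohrCompactification, ℂ) :=
  WeakDual.gelfandTransform ℂ almostPeriodic f

/-- The continuous function on `bℝ` which corresponds to `u_a`. -/
def u (a : ℝ) : C(BohrCompactification, ℂ) := extend (apExp a)

/-- The canonical map `ℝ → bℝ`, which sends `x` to the evaluation at `x`. -/
def ofReal (x : ℝ) : BohrCompactification :=
  WeakDual.CharacterSpace.equivAlgHom.symm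
    ({ toFun := fun f => (f : ℝ →ᵇ ℂ) x
       map_one' := rfl
       map_mul' := fun _ _ => rfl
       map_zero' := rfl
       map_add' := fun _ _ => rfl
       commutes' := fun _ => rfl } : almostPeriodic →ₐ[ℂ] ℂ)

theorem extend_ofReal (f : almostPeriodic) (x : ℝ) :
    extend f (ofReal x) = (f : ℝ →ᵇ ℂ) x := rfl

theorem u_ofReal (a x : ℝ) : u a (ofReal x) = Complex.exp (Complex.I * a * x) := rfl

theorem continuous_ofReal : Continuous ofReal :=
  Continuous.subtype_mk (WeakDual.continuous_of_continuous_eval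
    (fun f : almostPeriodic => (f : ℝ →ᵇ ℂ).continuous)) _

/-- `ℝ` is dense in `bℝ`. -/
theorem denseRange_ofReal : DenseRange ofReal := by
  intro χ
  by_contra hχ
  obtain ⟨g, hg0, hg1, -⟩ := exists_continuous_zero_one_of_isClosed
    (isClosed_closure (s := Set.range ofReal)) (isClosed_singleton (x := χ))
    (Set.disjoint_singleton_right.2 hχ)
  obtain ⟨f, hf⟩ := (gelfandTransform_bijective almostPeriodic).2
    ((⟨fun y => ((g y : ℝ) : ℂ), by fun_prop⟩ : C(BohrCompactification, ℂ)))
  have hf' : ∀ y : BohrCompactification, extend f y = ((g y : ℝ) : ℂ) :=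
    fun y => DFunLike.congr_fun hf y
  have hf0 : f = 0 := by
    ext x
    have h1 := hf' (ofReal x)
    rw [extend_ofReal, hg0 (subset_closure (Set.mem_range_self x))] at h1
    simpa using h1
  have h2 := hf' χ
  have h3 : extend 0 χ = 0 := map_zero (F := WeakDual.characterSpace ℂ almostPeriodic) χ
  rw [hg1 (Set.mem_singleton χ), hf0, h3] at h2
  simp at h2

end BohrCompactification

/-! ### Projection-valued measures -/

/-- A projection-valued measure on a measurable space `X`, acting on a complex Hilbert space `H`:
a map from the measurable sets to the orthogonal projections of `H` with `E ∅ = 0`, `E X = 1`,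
`E (S ∩ T) = E S * E T`, countably additive in the strong operator topology.
(On sets that are not measurable the value is `0` by convention.) -/
structure ProjectionValuedMeasure (X : Type*) [MeasurableSpace X]
    (H : Type*) [NormedAddCommGroup H] [InnerProductSpace ℂ H] [CompleteSpace H] where
  toFun : Set X → (H →L[ℂ] H)
  not_measurable : ∀ S, ¬ MeasurableSet S → toFun S = 0
  isStarProjection : ∀ S, MeasurableSet S → IsStarProjection (toFun S)
  empty : toFun ∅ = 0
  univ : toFun Set.univ = 1
  inter : ∀ S T, MeasurableSet S → MeasurableSet T → toFun (S ∩ T) = toFun S * toFun T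
  hasSum_iUnion : ∀ S : ℕ → Set X, (∀ n, MeasurableSet (S n)) →
    Pairwise (Function.onFun Disjoint S) →
      ∀ φ : H, HasSum (fun n => toFun (S n) φ) (toFun (⋃ n, S n) φ)

namespace ProjectionValuedMeasure

variable {X : Type*} [MeasurableSpace X]
  {H : Type*} [NormedAddCommGroup H] [InnerProductSpace ℂ H] [CompleteSpace H]

theorem inner_eq_norm_sq (E : ProjectionValuedMeasure X H) (φ : H) (S : Set X)
    (hS : MeasurableSet S) : ⟪φ, E.toFun S φ⟫_ℂ = ((‖E.toFun S φ‖ ^ 2 : ℝ) : ℂ) := by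
  have h := E.isStarProjection S hS
  have h1 : E.toFun S φ = E.toFun S (E.toFun S φ) := by
    conv_lhs => rw [← h.isIdempotentElem.eq]
    rfl
  have h2 : ContinuousLinearMap.adjoint (E.toFun S) = E.toFun S := h.isSelfAdjoint
  rw [h1, ← ContinuousLinearMap.adjoint_inner_left, h2, ← h1, inner_self_eq_norm_sq_to_K]
  simp

/-- The Borel measure `μ_φ(S) = ⟨φ, E(S) φ⟩` which belongs to a vector `φ`. -/
def vectorMeasure (E : ProjectionValuedMeasure X H) (φ : H) : Measure X :=
  Measure.ofMeasurable (fun S _ => ENNReal.ofReal (⟪φ, E.toFun S φ⟫_ℂ).re)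
    (by simp [E.empty])
    (by
      intro S hS hd
      have h := ((E.hasSum_iUnion S hS hd φ).mapL (innerSL ℂ φ)).mapL Complex.reCLM
      simp only [innerSL_apply_apply, Complex.reCLM_apply] at h
      have h0 : ∀ n, 0 ≤ (⟪φ, E.toFun (S n) φ⟫_ℂ).re := by
        intro n
        rw [E.inner_eq_norm_sq φ _ (hS n), Complex.ofReal_re]
        positivity
      rw [← h.tsum_eq, ENNReal.ofReal_tsum_of_nonneg h0 h.summable])

theorem vectorMeasure_apply (E : ProjectionValuedMeasure X H) (φ : H) (S : Set X)
    (hS : MeasurableSet S) :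
    E.vectorMeasure φ S = ENNReal.ofReal (⟪φ, E.toFun S φ⟫_ℂ).re :=
  Measure.ofMeasurable_apply S hS

instance (E : ProjectionValuedMeasure X H) (φ : H) : IsFiniteMeasure (E.vectorMeasure φ) :=
  ⟨by rw [E.vectorMeasure_apply φ _ MeasurableSet.univ]; exact ENNReal.ofReal_lt_top⟩

/-- `μ_φ(S) = ⟨φ, E(S) φ⟩` as an equality of complex numbers. -/
theorem vectorMeasure_real (E : ProjectionValuedMeasure X H) (φ : H) (S : Set X)
    (hS : MeasurableSet S) : (((E.vectorMeasure φ).real S : ℝ) : ℂ) = ⟪φ, E.toFun S φ⟫_ℂ := by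
  rw [measureReal_def, E.vectorMeasure_apply φ S hS, E.inner_eq_norm_sq φ S hS,
    Complex.ofReal_re, ENNReal.toReal_ofReal (by positivity)]

/-- `T = ∫ f dE`, i.e. `⟨φ, T φ⟩ = ∫ f dμ_φ` for all vectors `φ`, where `μ_φ(S) = ⟨φ, E(S) φ⟩`. -/
def HasIntegral (E : ProjectionValuedMeasure X H) (f : X → ℂ) (T : H →L[ℂ] H) : Prop :=
  ∀ φ : H, Integrable f (E.vectorMeasure φ) ∧ ⟪φ, T φ⟫_ℂ = ∫ x, f x ∂(E.vectorMeasure φ)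

end ProjectionValuedMeasure

/-! ### The Weyl algebra -/

/-- `A` is the Weyl algebra `𝒜[ℝ²]`, with canonical generators `U a` and `V b`: a (nonzero)
C⋆-algebra generated by two one-parameter groups of unitaries (no continuity is required) which
satisfy the Weyl form `U_a V_b = exp (-i a b) V_b U_a` of the canonical commutation relations. -/
structure IsWeylAlgebra {A : Type*} [CStarAlgebra A] (U V : ℝ → A) : Prop where
  nontrivial : Nontrivial A
  unitary_U : ∀ a, U a ∈ unitary A
  unitary_V : ∀ b, V b ∈ unitary A
  U_zero : U 0 = 1
  V_zero : V 0 = 1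
  U_add : ∀ a a', U (a + a') = U a * U a'
  V_add : ∀ b b', V (b + b') = V b * V b'
  ccr : ∀ a b, U a * V b = Complex.exp (-(Complex.I * a * b)) • (V b * U a)
  generates : (StarAlgebra.adjoin ℂ (Set.range U ∪ Set.range V)).topologicalClosure = ⊤

/-- A unital ⋆-representation of `A` on a Hilbert space `H ≠ 0` is irreducible if the only closed
subspaces of `H` that are invariant under all the operators `π x` are `0` and `H`. -/
def IsIrreducibleRep {A H : Type*} [CStarAlgebra A] [NormedAddCommGroup H]
    [InnerProductSpace ℂ H] [CompleteSpace H] (π : A →⋆ₐ[ℂ] (H →L[ℂ] H)) : Prop :=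
  Nontrivial H ∧ ∀ K : Submodule ℂ H, IsClosed (K : Set H) →
    (∀ x : A, ∀ φ ∈ K, π x φ ∈ K) → K = ⊥ ∨ K = ⊤

/-! ### A concrete Weyl algebra

The operators `(U_a f)(x) = exp (i a x) f(x)` and `(V_b f)(x) = f(x + b)` on `ℓ²(ℝ)` generate
a Weyl algebra, so that `IsWeylAlgebra` is satisfied. -/

namespace WeylModel

/-- The nonseparable Hilbert space `ℓ²(ℝ)`. -/
abbrev Hilb : Type := lp (fun _ : ℝ => ℂ) 2

/-- `f ↦ (x ↦ exp (i a x) f(x + b))` as a linear isometry of `ℓ²(ℝ)`. -/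
def weylIso (a b : ℝ) : Hilb →ₗᵢ[ℂ] Hilb where
  toFun f := ⟨fun x => Complex.exp (Complex.I * a * x) * f (x + b), by
    have h2 : 0 < (2 : ℝ≥0∞).toReal := by norm_num
    have hf := (memℓp_gen_iff h2).1 (lp.memℓp f)
    refine (memℓp_gen_iff h2).2 ?_
    have := (Equiv.addRight b).summable_iff.2 hf
    refine this.congr fun x => ?_
    have h : Complex.I * a * x = ((a * x : ℝ) : ℂ) * Complex.I := by push_cast; ring
    simp [h, Complex.norm_exp_ofReal_mul_I, -Complex.ofReal_mul]⟩
  map_add' f g := by ext x; simp [mul_add]; rfl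
  map_smul' c f := by ext x; simp; ring
  norm_map' f := by
    have h2 : 0 < (2 : ℝ≥0∞).toReal := by norm_num
    rw [lp.norm_eq_tsum_rpow h2, lp.norm_eq_tsum_rpow h2]
    congr 1
    rw [← (Equiv.addRight b).tsum_eq (fun x : ℝ => ‖f x‖ ^ (2 : ℝ≥0∞).toReal)]
    refine tsum_congr fun x => ?_
    have h : Complex.I * a * x = ((a * x : ℝ) : ℂ) * Complex.I := by push_cast; ring
    simp [h, Complex.norm_exp_ofReal_mul_I, -Complex.ofReal_mul]

theorem weylIso_apply (a b : ℝ) (f : Hilb) (x : ℝ) :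
    weylIso a b f x = Complex.exp (Complex.I * a * x) * f (x + b) := rfl

/-- `weylIso a b` as a bounded operator. -/
def weylOp (a b : ℝ) : Hilb →L[ℂ] Hilb := (weylIso a b).toContinuousLinearMap

theorem weylOp_apply (a b : ℝ) (f : Hilb) (x : ℝ) :
    weylOp a b f x = Complex.exp (Complex.I * a * x) * f (x + b) := rfl

theorem weylOp_mul (a b a' b' : ℝ) :
    weylOp a b * weylOp a' b' =
      Complex.exp (Complex.I * a' * b) • weylOp (a + a') (b + b') := by
  ext f x
  simp only [mul_apply_eq_comp, smul_apply, lp.coeFn_smul,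
    Pi.smul_apply, smul_eq_mul, weylOp_apply]
  rw [← mul_assoc, ← mul_assoc, ← Complex.exp_add, ← Complex.exp_add, ← add_assoc]
  congr 2
  push_cast
  ring

theorem weylOp_zero : weylOp 0 0 = 1 := by
  ext f x
  simp [weylOp_apply]

theorem weylOp_mem_unitary (a b : ℝ) : weylOp a b ∈ unitary (Hilb →L[ℂ] Hilb) := by
  have h1 : star (weylOp a b) * weylOp a b = 1 := by
    have h := (ContinuousLinearMap.norm_map_iff_adjoint_comp_self (weylOp a b)).1
      (weylIso a b).norm_map
    exact h
  have h2 : weylOp a b * (Complex.exp (Complex.I * a * b) • weylOp (-a) (-b)) = 1 := by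
    rw [mul_smul_comm, weylOp_mul, smul_smul, ← Complex.exp_add, add_neg_cancel, add_neg_cancel,
      weylOp_zero]
    simp
  have h3 := left_inv_eq_right_inv h1 h2
  refine Unitary.mem_iff.2 ⟨h1, ?_⟩
  rw [h3, h2]

/-- The C⋆-algebra generated by the operators `U_a` and `V_b` on `ℓ²(ℝ)`. -/
def algebra : StarSubalgebra ℂ (Hilb →L[ℂ] Hilb) :=
  (StarAlgebra.adjoin ℂ
    (Set.range (fun a => weylOp a 0) ∪ Set.range (fun b => weylOp 0 b))).topologicalClosure

instance isClosed_algebra : IsClosed (algebra : Set (Hilb →L[ℂ] Hilb)) :=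
  StarSubalgebra.isClosed_topologicalClosure _

/-- The position generators of the concrete Weyl algebra. -/
def U (a : ℝ) : algebra :=
  ⟨weylOp a 0, StarSubalgebra.le_topologicalClosure _
    (StarAlgebra.subset_adjoin ℂ _ (Or.inl ⟨a, rfl⟩))⟩

/-- The momentum generators of the concrete Weyl algebra. -/
def V (b : ℝ) : algebra :=
  ⟨weylOp 0 b, StarSubalgebra.le_topologicalClosure _
    (StarAlgebra.subset_adjoin ℂ _ (Or.inr ⟨b, rfl⟩))⟩

theorem isWeylAlgebra : IsWeylAlgebra U V where
  nontrivial := by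
    have : Nontrivial Hilb := by
      refine ⟨⟨lp.single 2 (0 : ℝ) (1 : ℂ), 0, fun h => ?_⟩⟩
      have := congrArg (fun f : Hilb => f 0) h
      simp at this
    infer_instance
  unitary_U a := by
    have h := Unitary.mem_iff.1 (weylOp_mem_unitary a 0)
    exact Unitary.mem_iff.2 ⟨Subtype.ext h.1, Subtype.ext h.2⟩
  unitary_V b := by
    have h := Unitary.mem_iff.1 (weylOp_mem_unitary 0 b)
    exact Unitary.mem_iff.2 ⟨Subtype.ext h.1, Subtype.ext h.2⟩
  U_zero := Subtype.ext weylOp_zero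
  V_zero := Subtype.ext weylOp_zero
  U_add a a' := Subtype.ext (by
    change weylOp (a + a') 0 = weylOp a 0 * weylOp a' 0
    simp [weylOp_mul])
  V_add b b' := Subtype.ext (by
    change weylOp 0 (b + b') = weylOp 0 b * weylOp 0 b'
    simp [weylOp_mul])
  ccr a b := Subtype.ext (by
    change weylOp a 0 * weylOp 0 b =
      Complex.exp (-(Complex.I * a * b)) • (weylOp 0 b * weylOp a 0)
    rw [weylOp_mul, weylOp_mul, smul_smul, ← Complex.exp_add]
    simp)
  generates := by
    rw [eq_top_iff]
    rintro ⟨x, hx⟩ -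
    have hmap : (StarAlgebra.adjoin ℂ (Set.range U ∪ Set.range V)).map algebra.subtype =
        StarAlgebra.adjoin ℂ
          (Set.range (fun a => weylOp a 0) ∪ Set.range (fun b => weylOp 0 b)) := by
      rw [StarAlgHom.map_adjoin, Set.image_union, ← Set.range_comp, ← Set.range_comp]
      rfl
    change _ ∈ closure _
    rw [Topology.IsInducing.subtypeVal.closure_eq_preimage_closure_image]
    have hx' : x ∈ closure ((StarAlgebra.adjoin ℂ (Set.range (fun a => weylOp a 0) ∪
        Set.range (fun b => weylOp 0 b)) : StarSubalgebra ℂ (Hilb →L[ℂ] Hilb)) :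
          Set (Hilb →L[ℂ] Hilb)) := hx
    rw [← hmap] at hx'
    exact hx'

end WeylModel

end

/-!
A one-parameter group of unitaries `W` on a Hilbert space, continuous or not, is the integral
`W_a = ∫ u_a dE` for some projection-valued measure `E` on the Bohr compactification
(`exists_hasIntegral_u`). The position and the momentum measure of a representation `π` come from
this fact for `π ∘ U` and for `π ∘ V`.

*From the group to a representation of `AP(ℝ)`.* One needs `‖Σ c_a W_a‖ ≤ sup |Σ c_a u_a|` for finite
sums (`norm_lift_le`); then `u_a ↦ W_a` extends by continuity to a representation of `AP(ℝ)`, hence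
of `C(bℝ)` (`exists_starAlgHom_apExp`). The supremum of a trigonometric polynomial `p` bounds each of
its coefficients (`norm_coeff_le_of_forall_norm_le`), so that `‖p(W)‖ ≤ N(p) sup |p|` with `N(p)` the
number of frequencies. For `r = p⋆ p` and exponents `k = 2ⁿ`, the C⋆-identity gives
`‖r(W)‖ ^ k = ‖(r ^ k)(W)‖ ≤ N(r ^ k) (sup |r|) ^ k`, where `N(r ^ k) ≤ (k + 1) ^ N(r)`
(`card_support_pow_le`). Since the factor grows only polynomially, `‖r(W)‖ ≤ sup |r|`. In effect this
is Kronecker's theorem, proved for operators.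

*From a representation of `C(X)` to a projection-valued measure.* For a representation `ρ` of `C(X)`,
`X` compact Hausdorff, the Riesz–Markov–Kakutani theorem yields regular measures `μ_φ` with
`∫ f dμ_φ = ⟨φ, ρ(f) φ⟩`, and `f ↦ ρ(f) φ` extends to an isometry `L²(μ_φ) → H`
(`cyclicIsometry`). The vector `E(S) φ` is defined as the image of the indicator function of `S`.
Regularity of `μ_φ + μ_ψ + μ_{φ + ψ}` provides real continuous functions `f_n` such that
`ρ(f_n) → E(S)` on all three vectors at once (`exists_tendsto_spectralVector`), and therefore `E(S)`
is linear and self-adjoint. Multiplicativity follows from `⟨φ, E(S) E(T) φ⟩ = μ_φ(S ∩ T)`, and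
countable additivity from that of `μ_φ`. By construction, `μ_φ` is the measure `⟨φ, E(·) φ⟩`, so that
`ρ(f) = ∫ f dE` (`hasIntegral_spectralMeasure`).
-/

noncomputable section

/-! ### Trigonometric polynomials and representations of `AP(ℝ)` -/

section TrigonometricPolynomials

open scoped Pointwise

/-- A coefficient of a trigonometric polynomial is bounded by the supremum of the polynomial.
Averaging `p(x)` and `e^{-iνh} p(x + h)` with `h = π / (t - ν)` keeps the coefficient of the
frequency `ν`, removes the frequency `t`, and does not increase the supremum. -/
theorem norm_coeff_le_of_forall_norm_le (ν C : ℝ) (S : Finset ℝ) (hν : ν ∉ S) (c : ℝ → ℂ)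
    (h : ∀ x : ℝ, ‖c ν * Complex.exp (Complex.I * ν * x) +
      ∑ s ∈ S, c s * Complex.exp (Complex.I * s * x)‖ ≤ C) : ‖c ν‖ ≤ C := by
  induction S using Finset.induction_on generalizing c with
  | empty => simpa using h 0
  | insert t S ht ih =>
    rw [Finset.mem_insert, not_or] at hν
    have hne : ((t : ℂ) - ν) ≠ 0 := by
      rw [← Complex.ofReal_sub, Complex.ofReal_ne_zero]
      exact sub_ne_zero.2 (Ne.symm hν.1)
    let δ : ℝ := Real.pi / (t - ν)
    let m : ℝ → ℂ := fun s => (1 + Complex.exp (Complex.I * (s - ν) * δ)) / 2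
    have hm1 : m ν = 1 := by simp [m]
    have hmt : m t = 0 := by
      have : Complex.I * (t - ν) * δ = Real.pi * Complex.I := by
        simp only [δ, Complex.ofReal_div, Complex.ofReal_sub]
        field_simp
      simp [m, this, Complex.exp_pi_mul_I]
    have key : ∀ (s x : ℝ), m s * (c s * Complex.exp (Complex.I * s * x)) =
        (c s * Complex.exp (Complex.I * s * x) + Complex.exp (-(Complex.I * ν * δ)) *
          (c s * Complex.exp (Complex.I * s * (x + δ : ℝ)))) / 2 := by
      intro s x
      have e1 : Complex.exp (Complex.I * s * (x + δ : ℝ)) = Complex.exp (Complex.I * s * x) *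
          Complex.exp (Complex.I * s * δ) := by
        rw [← Complex.exp_add]; congr 1; push_cast; ring
      have e2 : Complex.exp (Complex.I * (s - ν) * δ) = Complex.exp (Complex.I * s * δ) *
          Complex.exp (-(Complex.I * ν * δ)) := by
        rw [← Complex.exp_add]; congr 1; ring
      simp only [m]
      rw [e1, e2]
      ring
    have := ih hν.2 (fun s => m s * c s) (fun x => ?_)
    · simpa [hm1] using this
    have hx : (m ν * c ν) * Complex.exp (Complex.I * ν * x) +
        ∑ s ∈ S, (m s * c s) * Complex.exp (Complex.I * s * x) =
        ((c ν * Complex.exp (Complex.I * ν * x) +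
          ∑ s ∈ insert t S, c s * Complex.exp (Complex.I * s * x)) +
        Complex.exp (-(Complex.I * ν * δ)) * (c ν * Complex.exp (Complex.I * ν * (x + δ : ℝ)) +
          ∑ s ∈ insert t S, c s * Complex.exp (Complex.I * s * (x + δ : ℝ)))) / 2 := by
      have hs : ∑ s ∈ S, (m s * c s) * Complex.exp (Complex.I * s * x) =
          ∑ s ∈ insert t S, m s * (c s * Complex.exp (Complex.I * s * x)) := by
        rw [Finset.sum_insert ht, hmt, zero_mul, zero_add]
        exact Finset.sum_congr rfl fun s _ => mul_assoc _ _ _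
      rw [hs, mul_assoc, key, Finset.sum_congr rfl fun s _ => key s x, ← Finset.sum_div,
        Finset.sum_add_distrib, ← Finset.mul_sum]
      ring
    have hexp : ‖Complex.exp (-(Complex.I * ν * δ))‖ = 1 := by
      have : -(Complex.I * ν * δ) = ((-(ν * δ) : ℝ) : ℂ) * Complex.I := by push_cast; ring
      rw [this, Complex.norm_exp_ofReal_mul_I]
    rw [hx, norm_div, Complex.norm_ofNat, div_le_iff₀ two_pos]
    refine (norm_add_le _ _).trans ?_
    rw [norm_mul, hexp, one_mul]
    linarith [h x, h (x + δ)]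

/-- The homomorphism `a ↦ u_a` into `AP(ℝ)`. -/
def apExpHom : Multiplicative ℝ →* almostPeriodic where
  toFun a := apExp a.toAdd
  map_one' := by
    refine Subtype.ext (BoundedContinuousFunction.ext fun x => ?_)
    change Complex.exp (Complex.I * ((0 : ℝ) : ℂ) * x) = 1
    simp
  map_mul' a b := by
    refine Subtype.ext (BoundedContinuousFunction.ext fun x => ?_)
    change Complex.exp (Complex.I * ((a.toAdd + b.toAdd : ℝ) : ℂ) * x) =
      Complex.exp (Complex.I * a.toAdd * x) * Complex.exp (Complex.I * b.toAdd * x)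
    rw [← Complex.exp_add]
    congr 1
    push_cast
    ring

/-- The formal trigonometric polynomial `Σ c_a a`, realised as the function `Σ c_a u_a` in
`AP(ℝ)`. -/
def trigPoly : AddMonoidAlgebra ℂ ℝ →ₐ[ℂ] almostPeriodic := AddMonoidAlgebra.lift ℂ _ ℝ apExpHom

theorem trigPoly_single (a : ℝ) (c : ℂ) :
    trigPoly (AddMonoidAlgebra.single a c) = c • apExp a := by
  rw [trigPoly, AddMonoidAlgebra.lift_single]
  rfl

theorem trigPoly_apply (q : AddMonoidAlgebra ℂ ℝ) (x : ℝ) :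
    (trigPoly q : ℝ →ᵇ ℂ) x =
      ∑ a ∈ q.coeff.support, q.coeff a * Complex.exp (Complex.I * a * x) := by
  have h : (trigPoly q : ℝ →ᵇ ℂ) = ∑ a ∈ q.coeff.support, q.coeff a • expFun a := by
    rw [trigPoly, AddMonoidAlgebra.lift_apply, Finsupp.sum]
    push_cast
    rfl
  rw [h, BoundedContinuousFunction.coe_sum, Finset.sum_apply]
  rfl

theorem norm_coeff_le_norm_trigPoly (q : AddMonoidAlgebra ℂ ℝ) (ν : ℝ) :
    ‖q.coeff ν‖ ≤ ‖trigPoly q‖ := by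
  classical
  by_cases hν : ν ∈ q.coeff.support
  · refine norm_coeff_le_of_forall_norm_le ν _ (q.coeff.support.erase ν)
      (Finset.notMem_erase _ _) q.coeff fun x => ?_
    rw [Finset.add_sum_erase _ (fun a => q.coeff a * Complex.exp (Complex.I * a * x)) hν,
      ← trigPoly_apply]
    exact BoundedContinuousFunction.norm_coe_le_norm _ _
  · rw [Finsupp.notMem_support_iff.1 hν, norm_zero]
    exact norm_nonneg _

/-- A frequency of `q ^ k` is a sum of `k` frequencies of `q`, repetitions allowed. -/
theorem exists_eq_sum_of_mem_support_pow (q : AddMonoidAlgebra ℂ ℝ) (k : ℕ) :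
    ∀ a ∈ (q ^ k).coeff.support, ∃ n : ℝ → ℕ, (∀ s, n s ≤ k) ∧
      a = ∑ s ∈ q.coeff.support, (n s : ℝ) * s := by
  classical
  induction k with
  | zero =>
    intro a ha
    have : a = 0 := by
      by_contra h
      rw [pow_zero, Finsupp.mem_support_iff, AddMonoidAlgebra.one_def,
        AddMonoidAlgebra.coeff_single, Finsupp.single_apply, if_neg (Ne.symm h)] at ha
      exact ha rfl
    exact ⟨0, fun _ => le_rfl, by simp [this]⟩
  | succ k ih =>
    intro a ha
    rw [pow_succ] at ha
    obtain ⟨b, hb, t, ht, rfl⟩ :=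
      Finset.mem_add.1 (AddMonoidAlgebra.support_coeff_mul_subset _ _ ha)
    obtain ⟨n, hn, rfl⟩ := ih b hb
    refine ⟨fun s => n s + if s = t then 1 else 0, fun s => ?_, ?_⟩
    · have := hn s
      dsimp only
      split_ifs <;> omega
    · simp only [Nat.cast_add, add_mul, Finset.sum_add_distrib]
      congr 1
      rw [Finset.sum_eq_single_of_mem t ht fun s _ hs => by simp [hs]]
      simp

/-- The number of frequencies of `q ^ k` grows polynomially in `k`. -/
theorem card_support_pow_le (q : AddMonoidAlgebra ℂ ℝ) (k : ℕ) :
    (q ^ k).coeff.support.card ≤ (k + 1) ^ q.coeff.support.card := by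
  classical
  -- The multiplicities of the frequencies of `q`, each at most `k`, determine one of `q ^ k`.
  let P := q.coeff.support.pi fun _ => Finset.range (k + 1)
  let F : (∀ s ∈ q.coeff.support, ℕ) → ℝ :=
    fun n => ∑ s ∈ q.coeff.support.attach, (n s.1 s.2 : ℝ) * s.1
  have hsub : (q ^ k).coeff.support ⊆ P.image F := by
    intro a ha
    obtain ⟨n, hn, rfl⟩ := exists_eq_sum_of_mem_support_pow q k a ha
    refine Finset.mem_image.2 ⟨fun s _ => n s, ?_, ?_⟩
    · exact Finset.mem_pi.2 fun s _ => Finset.mem_range.2 (Nat.lt_succ_of_le (hn s))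
    · exact Finset.sum_attach _ fun s => (n s : ℝ) * s
  refine (Finset.card_le_card hsub).trans (Finset.card_image_le.trans ?_)
  rw [Finset.card_pi, Finset.prod_const, Finset.card_range]

/-- If the powers `x ^ k` exceed the powers `y ^ k` at most by a factor polynomial in `k`, for the
exponents `k = 2 ^ n`, then `x ≤ y`. -/
theorem le_of_pow_two_pow_le {x y : ℝ} (hy : 0 ≤ y) (m : ℕ)
    (h : ∀ n : ℕ, x ^ 2 ^ n ≤ ((2 ^ n : ℕ) + 1 : ℝ) ^ m * y ^ 2 ^ n) : x ≤ y := by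
  by_contra! hlt
  have hx : 0 < x := hy.trans_lt hlt
  rcases hy.eq_or_lt with rfl | hy
  · have := h 0
    simp only [pow_zero, pow_one, mul_zero] at this
    exact absurd this (not_le.2 hx)
  have hr : 1 < x / y := (one_lt_div hy).2 hlt
  have hlim := ((tendsto_pow_const_div_const_pow_of_one_lt m hr).comp
    (Filter.tendsto_add_atTop_nat 1)).comp (tendsto_pow_atTop_atTop_of_one_lt (one_lt_two (α := ℕ)))
  obtain ⟨n, hn⟩ := (hlim.eventually (gt_mem_nhds (inv_pos.2 (zero_lt_one.trans hr)))).exists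
  have hpos : (0 : ℝ) < (x / y) ^ (2 ^ n + 1) := by positivity
  simp only [Function.comp_apply] at hn
  rw [div_lt_iff₀ hpos, pow_succ', inv_mul_cancel_left₀ (zero_lt_one.trans hr).ne', div_pow,
    lt_div_iff₀ (by positivity)] at hn
  have := h n
  push_cast at hn this
  exact absurd this (not_le.2 hn)

/-- The range of polynomials is closed under `star`, compatibly for the functions `u_a` and for the
unitaries `W_a`: both have the inverse of a generator as its adjoint. -/
theorem exists_star_eq_lift {B : Type*} [CStarAlgebra B] (W : Multiplicative ℝ →* B)
    (hW : ∀ a, W a ∈ unitary B) (q : AddMonoidAlgebra ℂ ℝ) :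
    ∃ r : AddMonoidAlgebra ℂ ℝ, trigPoly r = star (trigPoly q) ∧
      AddMonoidAlgebra.lift ℂ B ℝ W r = star (AddMonoidAlgebra.lift ℂ B ℝ W q) := by
  induction q using AddMonoidAlgebra.induction_on with
  | of a =>
    refine ⟨AddMonoidAlgebra.single (-a) 1, ?_, ?_⟩
    · rw [trigPoly_single, one_smul, AddMonoidAlgebra.of_apply, trigPoly_single, one_smul]
      refine Subtype.ext (BoundedContinuousFunction.ext fun x => ?_)
      change Complex.exp (Complex.I * ((-a : ℝ) : ℂ) * x) =
        (starRingEnd ℂ) (Complex.exp (Complex.I * a * x))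
      rw [← Complex.exp_conj]
      simp
    · rw [AddMonoidAlgebra.lift_single, one_smul, AddMonoidAlgebra.lift_of]
      refine left_inv_eq_right_inv (a := W (Multiplicative.ofAdd a)) ?_
        (Unitary.mem_iff.1 (hW _)).2
      rw [← map_mul, ← ofAdd_add, neg_add_cancel, ofAdd_zero, map_one]
  | add q q' h h' =>
    obtain ⟨r, h1, h2⟩ := h
    obtain ⟨r', h1', h2'⟩ := h'
    exact ⟨r + r', by simp only [map_add, star_add, h1, h1'],
      by simp only [map_add, star_add, h2, h2']⟩
  | smul c q h =>
    obtain ⟨r, h1, h2⟩ := h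
    exact ⟨star c • r, by simp only [map_smul, star_smul, h1],
      by simp only [map_smul, star_smul, h2]⟩

/-- For a one-parameter group of unitaries `W`, the norm of `Σ c_a W_a` is bounded by the supremum
of `Σ c_a u_a`. Up to the number of frequencies this is the bound on coefficients; that number is
polynomial in the exponent for powers of the polynomial, and so the C⋆-identity removes it. -/
theorem norm_lift_le {B : Type*} [CStarAlgebra B] (W : Multiplicative ℝ →* B)
    (hW : ∀ a, W a ∈ unitary B) (q : AddMonoidAlgebra ℂ ℝ) :
    ‖AddMonoidAlgebra.lift ℂ B ℝ W q‖ ≤ ‖trigPoly q‖ := by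
  have hcard : ∀ q : AddMonoidAlgebra ℂ ℝ, ‖AddMonoidAlgebra.lift ℂ B ℝ W q‖ ≤
      q.coeff.support.card * ‖trigPoly q‖ := by
    intro q
    rw [AddMonoidAlgebra.lift_apply, Finsupp.sum, ← nsmul_eq_mul]
    refine (norm_sum_le _ _).trans (Finset.sum_le_card_nsmul _ _ _ fun a _ => ?_)
    rw [norm_smul]
    refine (mul_le_of_le_one_right (norm_nonneg _) ?_).trans (norm_coeff_le_norm_trigPoly q a)
    cases subsingleton_or_nontrivial B
    · rw [Subsingleton.elim (W _) 0, norm_zero]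
      exact zero_le_one
    · exact (CStarRing.norm_of_mem_unitary (hW _)).le
  obtain ⟨r, h1, h2⟩ := exists_star_eq_lift W hW q
  have hL : AddMonoidAlgebra.lift ℂ B ℝ W (r * q) =
      star (AddMonoidAlgebra.lift ℂ B ℝ W q) * AddMonoidAlgebra.lift ℂ B ℝ W q := by
    rw [map_mul, h2]
  have hT : trigPoly (r * q) = star (trigPoly q) * trigPoly q := by rw [map_mul, h1]
  have hsa : IsSelfAdjoint (AddMonoidAlgebra.lift ℂ B ℝ W (r * q)) := by
    rw [hL]; exact IsSelfAdjoint.star_mul_self _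
  have hle : ‖AddMonoidAlgebra.lift ℂ B ℝ W (r * q)‖ ≤ ‖trigPoly (r * q)‖ := by
    refine le_of_pow_two_pow_le (norm_nonneg _) (r * q).coeff.support.card fun n => ?_
    rw [← hsa.norm_pow_two_pow, ← map_pow]
    refine (hcard _).trans ?_
    rw [map_pow]
    gcongr
    · exact_mod_cast card_support_pow_le (r * q) (2 ^ n)
    · exact norm_pow_le' _ (by positivity)
  have hT' : ‖star (trigPoly q) * trigPoly q‖ = ‖trigPoly q‖ * ‖trigPoly q‖ :=
    CStarRing.norm_star_mul_self
  rw [hL, hT, CStarRing.norm_star_mul_self, hT'] at hle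
  exact (mul_self_le_mul_self_iff (norm_nonneg _) (norm_nonneg _)).2 hle

theorem denseRange_trigPoly : DenseRange trigPoly := by
  have hrange : ∀ f ∈ StarAlgebra.adjoin ℂ (Set.range expFun),
      ∃ q, (trigPoly q : ℝ →ᵇ ℂ) = f := by
    intro f hf
    induction hf using StarAlgebra.adjoin_induction with
    | mem f hf =>
      obtain ⟨a, rfl⟩ := hf
      exact ⟨AddMonoidAlgebra.single a 1, by rw [trigPoly_single, one_smul]; rfl⟩
    | algebraMap c => exact ⟨algebraMap ℂ _ c, by rw [AlgHom.commutes]; rfl⟩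
    | add f g _ _ hf hg =>
      obtain ⟨q, rfl⟩ := hf
      obtain ⟨r, rfl⟩ := hg
      exact ⟨q + r, by rw [map_add]; rfl⟩
    | mul f g _ _ hf hg =>
      obtain ⟨q, rfl⟩ := hf
      obtain ⟨r, rfl⟩ := hg
      exact ⟨q * r, by rw [map_mul]; rfl⟩
    | star f _ hf =>
      obtain ⟨q, rfl⟩ := hf
      -- Only the function part is needed, so the trivial one-parameter group will do.
      obtain ⟨r, hr, -⟩ := exists_star_eq_lift (B := ℂ) 1 (fun _ => one_mem _) q
      exact ⟨r, by rw [hr]; rfl⟩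
  rintro ⟨f, hf⟩
  rw [Topology.IsInducing.subtypeVal.closure_eq_preimage_closure_image]
  change f ∈ closure _
  refine closure_mono (fun g hg => ?_) (show f ∈ closure _ from hf)
  obtain ⟨q, hq⟩ := hrange g hg
  exact ⟨trigPoly q, ⟨q, rfl⟩, hq⟩

/-- Every one-parameter group of unitaries `W`, continuous or not, extends to a representation of
`AP(ℝ)` with `u_a ↦ W_a`. -/
theorem exists_starAlgHom_apExp {B : Type*} [CStarAlgebra B] (W : Multiplicative ℝ →* B)
    (hW : ∀ a, W a ∈ unitary B) :
    ∃ ρ : almostPeriodic →⋆ₐ[ℂ] B, ∀ a : ℝ, ρ (apExp a) = W (Multiplicative.ofAdd a) := by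
  -- The assignment `Σ c_a u_a ↦ Σ c_a W_a` is a contraction on a dense subspace.
  let L := (AddMonoidAlgebra.lift ℂ B ℝ W).toLinearMap.extendOfNorm trigPoly.toLinearMap
  have hL : ∀ q, L (trigPoly q) = AddMonoidAlgebra.lift ℂ B ℝ W q := fun q =>
    LinearMap.extendOfNorm_eq denseRange_trigPoly
      ⟨1, fun q => by rw [one_mul]; exact norm_lift_le W hW q⟩ q
  have hmul : ∀ f g, L (f * g) = L f * L g := by
    intro f g
    refine denseRange_trigPoly.induction_on₂
      (isClosed_eq (by fun_prop) (by fun_prop)) (fun q r => ?_) f g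
    rw [← map_mul, hL, hL, hL, map_mul]
  have hstar : ∀ f, L (star f) = star (L f) := by
    intro f
    refine denseRange_trigPoly.induction_on f
      (isClosed_eq (L.continuous.comp continuous_star) (by fun_prop)) fun q => ?_
    obtain ⟨r, h1, h2⟩ := exists_star_eq_lift W hW q
    rw [← h1, hL, hL, h2]
  have hone : L 1 = 1 := by rw [← map_one trigPoly, hL, map_one]
  refine ⟨{ AlgHom.ofLinearMap L.toLinearMap hone hmul with map_star' := hstar }, fun a => ?_⟩
  change L (apExp a) = _
  rw [← one_smul ℂ (apExp a), ← trigPoly_single, hL, AddMonoidAlgebra.lift_single, one_smul]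

end TrigonometricPolynomials

/-! ### The spectral measure of a representation of `C(X)` -/

section SpectralMeasure

open Filter Topology
open scoped CompactlySupported

variable {X : Type*} [TopologicalSpace X]
  {H : Type*} [NormedAddCommGroup H] [InnerProductSpace ℂ H] [CompleteSpace H]

/-- A real continuous function, regarded as a complex one. -/
def ContinuousMap.complexify (f : C(X, ℝ)) : C(X, ℂ) :=
  ⟨fun x => (f x : ℂ), by fun_prop⟩

theorem ContinuousMap.complexify_apply (f : C(X, ℝ)) (x : X) : f.complexify x = (f x : ℂ) := rfl

theorem ContinuousMap.star_complexify (f : C(X, ℝ)) : star f.complexify = f.complexify := by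
  ext x
  simp [complexify_apply]

variable (ρ : C(X, ℂ) →⋆ₐ[ℂ] (H →L[ℂ] H))

theorem inner_map_map_star (f : C(X, ℂ)) (φ ψ : H) : ⟪ρ f φ, ψ⟫_ℂ = ⟪φ, ρ (star f) ψ⟫_ℂ := by
  rw [map_star, ContinuousLinearMap.star_eq_adjoint, ContinuousLinearMap.adjoint_inner_right]

/-- The state `f ↦ ⟨φ, ρ(f) φ⟩` is positive, because a nonnegative function is the square of a
real one. -/
theorem inner_map_complexify_nonneg (f : C(X, ℝ)) (hf : ∀ x, 0 ≤ f x) (φ : H) :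
    0 ≤ (⟪φ, ρ f.complexify φ⟫_ℂ).re := by
  let g : C(X, ℝ) := ⟨fun x => √(f x), by fun_prop⟩
  have h : f.complexify = star g.complexify * g.complexify := by
    ext x
    rw [ContinuousMap.star_complexify, ContinuousMap.mul_apply]
    simp only [ContinuousMap.complexify_apply]
    rw [← Complex.ofReal_mul]
    congr 1
    exact (Real.mul_self_sqrt (hf x)).symm
  rw [h, map_mul, mul_apply_eq_comp, ← inner_map_map_star]
  exact inner_self_nonneg (𝕜 := ℂ)

variable [CompactSpace X] [T2Space X] [MeasurableSpace X] [BorelSpace X]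

/-- By the Riesz–Markov–Kakutani theorem, the state `f ↦ ⟨φ, ρ(f) φ⟩` is integration against a
regular measure. -/
theorem exists_regular_integral_eq_inner (φ : H) :
    ∃ μ : Measure X, IsFiniteMeasure μ ∧ μ.Regular ∧
      ∀ f : C(X, ℂ), ∫ x, f x ∂μ = ⟪φ, ρ f φ⟫_ℂ := by
  let l : C_c(X, ℝ) →ₗ[ℝ] ℝ :=
    { toFun := fun f => (⟪φ, ρ (f : C(X, ℝ)).complexify φ⟫_ℂ).re
      map_add' := fun f g => by
        have : ((f + g : C_c(X, ℝ)) : C(X, ℝ)).complexify =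
            (f : C(X, ℝ)).complexify + (g : C(X, ℝ)).complexify := by
          ext x; simp [ContinuousMap.complexify_apply]
        rw [this, map_add, add_apply, inner_add_right, Complex.add_re]
      map_smul' := fun c f => by
        have : ((c • f : C_c(X, ℝ)) : C(X, ℝ)).complexify =
            (c : ℂ) • (f : C(X, ℝ)).complexify := by
          ext x; simp [ContinuousMap.complexify_apply]
        rw [this, map_smul, smul_apply, inner_smul_right, Complex.re_ofReal_mul]
        rfl }
  let L : C_c(X, ℝ) →ₚ[ℝ] ℝ := PositiveLinearMap.mk₀ l
    fun f hf => inner_map_complexify_nonneg ρ _ hf φ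
  refine ⟨RealRMK.rieszMeasure L, inferInstance, inferInstance, fun f => ?_⟩
  have hreal : ∀ g : C(X, ℝ), ((∫ x, g x ∂(RealRMK.rieszMeasure L) : ℝ) : ℂ) =
      ⟪φ, ρ g.complexify φ⟫_ℂ := by
    intro g
    have h1 : ∫ x, g x ∂(RealRMK.rieszMeasure L) = (⟪φ, ρ g.complexify φ⟫_ℂ).re :=
      RealRMK.integral_rieszMeasure L (CompactlySupportedContinuousMap.continuousMapEquiv g)
    rw [h1, ← Complex.conj_eq_iff_re, inner_conj_symm, inner_map_map_star,
      ContinuousMap.star_complexify]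
  let fr : C(X, ℝ) := ⟨fun x => (f x).re, by fun_prop⟩
  let fi : C(X, ℝ) := ⟨fun x => (f x).im, by fun_prop⟩
  have hint : Integrable (fun x => f x) (RealRMK.rieszMeasure L) :=
    f.continuous.integrable_of_hasCompactSupport (HasCompactSupport.of_compactSpace _)
  have hf : f = fr.complexify + Complex.I • fi.complexify := by
    ext x
    simp [ContinuousMap.complexify_apply, fr, fi, mul_comm Complex.I, Complex.re_add_im]
  rw [← integral_re_add_im hint]
  conv_rhs => rw [hf, map_add, map_smul, add_apply, inner_add_right, smul_apply, inner_smul_right,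
    ← hreal, ← hreal]
  simp [fr, fi, mul_comm]

/-- The regular measure on `X` which represents the state `f ↦ ⟨φ, ρ(f) φ⟩`. -/
def scalarMeasure (φ : H) : Measure X := (exists_regular_integral_eq_inner ρ φ).choose

instance (φ : H) : IsFiniteMeasure (scalarMeasure ρ φ) :=
  (exists_regular_integral_eq_inner ρ φ).choose_spec.1

instance (φ : H) : (scalarMeasure ρ φ).Regular :=
  (exists_regular_integral_eq_inner ρ φ).choose_spec.2.1

theorem integral_scalarMeasure (φ : H) (f : C(X, ℂ)) :
    ∫ x, f x ∂(scalarMeasure ρ φ) = ⟪φ, ρ f φ⟫_ℂ :=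
  (exists_regular_integral_eq_inner ρ φ).choose_spec.2.2 f

theorem norm_map_apply_eq_norm_toLp (φ : H) (f : C(X, ℂ)) :
    ‖ρ f φ‖ = ‖ContinuousMap.toLp (E := ℂ) 2 (scalarMeasure ρ φ) ℂ f‖ := by
  rw [← sq_eq_sq₀ (norm_nonneg _) (norm_nonneg _)]
  have h : ((‖ρ f φ‖ ^ 2 : ℝ) : ℂ) =
      ((‖ContinuousMap.toLp (E := ℂ) 2 (scalarMeasure ρ φ) ℂ f‖ ^ 2 : ℝ) : ℂ) := by
    have h1 := inner_self_eq_norm_sq_to_K (𝕜 := ℂ) (ρ f φ)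
    have h2 := inner_self_eq_norm_sq_to_K (𝕜 := ℂ)
      (ContinuousMap.toLp (E := ℂ) 2 (scalarMeasure ρ φ) ℂ f)
    rw [inner_map_map_star, ← mul_apply_eq_comp, ← map_mul, ← integral_scalarMeasure] at h1
    rw [ContinuousMap.inner_toLp] at h2
    push_cast
    refine h1.symm.trans (Eq.trans ?_ h2)
    simp [mul_comm]
  exact_mod_cast h

/-- The isometry `L²(X, μ_φ) → H` which extends `f ↦ ρ(f) φ` from the continuous functions. -/
def cyclicIsometry (φ : H) : Lp ℂ 2 (scalarMeasure ρ φ) →ₗᵢ[ℂ] H where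
  toLinearMap := ((ContinuousLinearMap.apply ℂ H φ).toLinearMap ∘ₗ
      (ρ : C(X, ℂ) →ₗ[ℂ] (H →L[ℂ] H))).extendOfNorm
    (ContinuousMap.toLp (E := ℂ) 2 (scalarMeasure ρ φ) ℂ).toLinearMap
  norm_map' := by
    have hd := ContinuousMap.toLp_denseRange ℂ (scalarMeasure ρ φ) ℂ (p := 2) (by simp)
    refine hd.induction ?_ (isClosed_eq (by simp only [ContinuousLinearMap.coe_coe]; fun_prop)
      continuous_norm)
    rintro _ ⟨f, rfl⟩
    rw [← norm_map_apply_eq_norm_toLp]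
    exact congrArg norm (LinearMap.extendOfNorm_eq hd
      ⟨1, fun f => by rw [one_mul]; exact (norm_map_apply_eq_norm_toLp ρ φ f).le⟩ f)

theorem cyclicIsometry_toLp (φ : H) (f : C(X, ℂ)) :
    cyclicIsometry ρ φ (ContinuousMap.toLp (E := ℂ) 2 (scalarMeasure ρ φ) ℂ f) = ρ f φ :=
  LinearMap.extendOfNorm_eq
    (ContinuousMap.toLp_denseRange ℂ (scalarMeasure ρ φ) ℂ (p := 2) (by simp))
    ⟨1, fun f => by rw [one_mul]; exact (norm_map_apply_eq_norm_toLp ρ φ f).le⟩ f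

/-- The vector `E(S) φ`: the image of the indicator function of `S` under the isometry
`L²(X, μ_φ) → H`. -/
def spectralVector {S : Set X} (hS : MeasurableSet S) (φ : H) : H :=
  cyclicIsometry ρ φ (indicatorConstLp 2 hS (measure_ne_top _ _) (1 : ℂ))

/-- `⟨E(S) φ, E(T) φ⟩ = μ_φ(S ∩ T)`; this yields the multiplicativity of `E`. -/
theorem inner_spectralVector {S T : Set X} (hS : MeasurableSet S) (hT : MeasurableSet T) (φ : H) :
    ⟪spectralVector ρ hS φ, spectralVector ρ hT φ⟫_ℂ = (scalarMeasure ρ φ).real (S ∩ T) := by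
  rw [spectralVector, spectralVector, LinearIsometry.inner_map_map,
    L2.inner_indicatorConstLp_one_indicatorConstLp_one]
  rfl

theorem norm_spectralVector_sq {S : Set X} (hS : MeasurableSet S) (φ : H) :
    ‖spectralVector ρ hS φ‖ ^ 2 = (scalarMeasure ρ φ).real S := by
  have h := inner_spectralVector ρ hS hS φ
  rw [inner_self_eq_norm_sq_to_K, Set.inter_self] at h
  exact Complex.ofReal_injective (by rw [← h]; exact Complex.ofReal_pow _ _)

theorem spectralVector_univ (φ : H) : spectralVector ρ MeasurableSet.univ φ = φ := by
  have h := cyclicIsometry_toLp ρ φ 1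
  rw [map_one ρ, one_apply_eq_self] at h
  rw [spectralVector]
  conv_rhs => rw [← h]
  congr 1
  refine Lp.ext ?_
  filter_upwards [indicatorConstLp_coeFn (p := 2) (μ := scalarMeasure ρ φ) (c := (1 : ℂ))
    (hs := MeasurableSet.univ) (hμs := measure_ne_top _ _),
    ContinuousMap.coeFn_toLp (p := 2) (𝕜 := ℂ) (scalarMeasure ρ φ) (1 : C(X, ℂ))] with x h1 h2
  rw [h1, h2]
  simp

theorem norm_spectralVector_le {S : Set X} (hS : MeasurableSet S) (φ : H) :
    ‖spectralVector ρ hS φ‖ ≤ ‖φ‖ := by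
  rw [← sq_le_sq₀ (norm_nonneg _) (norm_nonneg _), norm_spectralVector_sq]
  conv_rhs => rw [← spectralVector_univ ρ φ, norm_spectralVector_sq]
  exact measureReal_mono (Set.subset_univ _)

theorem spectralVector_union {S T : Set X} (hS : MeasurableSet S) (hT : MeasurableSet T)
    (hd : Disjoint S T) (φ : H) :
    spectralVector ρ (hS.union hT) φ = spectralVector ρ hS φ + spectralVector ρ hT φ := by
  rw [spectralVector, indicatorConstLp_disjoint_union hS hT (measure_ne_top _ _)
    (measure_ne_top _ _) hd, map_add]
  rfl

/-- Real continuous functions `f` approximate the indicator function of `S` in `L²(ν)`; then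
`ρ(f)` approximates `E(S)` at once on all vectors `φ` with `μ_φ ≤ ν`. -/
theorem exists_norm_spectralVector_sub_le {S : Set X} (hS : MeasurableSet S) (ν : Measure X)
    [IsFiniteMeasure ν] [ν.WeaklyRegular] {ε : ℝ} (hε : 0 < ε) :
    ∃ f : C(X, ℝ), ∀ φ : H, scalarMeasure ρ φ ≤ ν →
      ‖spectralVector ρ hS φ - ρ f.complexify φ‖ ≤ ε := by
  have hmem : MemLp (S.indicator fun _ => (1 : ℝ)) 2 ν :=
    memLp_indicator_const 2 hS 1 (Or.inr (measure_ne_top _ _))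
  obtain ⟨g, hg, -⟩ := hmem.exists_boundedContinuous_eLpNorm_sub_le (by simp)
    (ENNReal.ofReal_pos.2 hε).ne'
  refine ⟨g.toContinuousMap, fun φ hφ => ?_⟩
  rw [← cyclicIsometry_toLp, spectralVector, ← map_sub, LinearIsometry.norm_map, Lp.norm_def]
  refine ENNReal.toReal_le_of_le_ofReal hε.le ((Eq.le ?_).trans
    ((eLpNorm_mono_measure _ hφ).trans hg))
  refine eLpNorm_congr_norm_ae ?_
  filter_upwards [indicatorConstLp_coeFn (p := 2) (μ := scalarMeasure ρ φ) (c := (1 : ℂ))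
    (hs := hS) (hμs := measure_ne_top _ _),
    ContinuousMap.coeFn_toLp (p := 2) (𝕜 := ℂ) (scalarMeasure ρ φ)
      (ContinuousMap.complexify g.toContinuousMap), Lp.coeFn_sub
      (indicatorConstLp 2 hS (measure_ne_top (scalarMeasure ρ φ) _) (1 : ℂ))
      (ContinuousMap.toLp (E := ℂ) 2 (scalarMeasure ρ φ) ℂ
        (ContinuousMap.complexify g.toContinuousMap))] with x h1 h2 h3
  rw [h3, Pi.sub_apply, Pi.sub_apply, h1, h2, ← Complex.norm_real]
  congr 1
  by_cases hx : x ∈ S <;> simp [hx, ContinuousMap.complexify_apply]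

/-- On finitely many vectors at once, `E(S)` is a pointwise limit of operators `ρ(f_n)`, with `f_n`
real and continuous. -/
theorem exists_tendsto_spectralVector {S : Set X} (hS : MeasurableSet S) (s : Finset H) :
    ∃ f : ℕ → C(X, ℝ), ∀ φ ∈ s,
      Tendsto (fun n => ρ (f n).complexify φ) atTop (𝓝 (spectralVector ρ hS φ)) := by
  let ν : Measure X := ∑ φ ∈ s, scalarMeasure ρ φ
  -- Inner regularity passes to sums, and for finite measures it implies weak regularity.
  have hν : IsFiniteMeasure ν ∧ ν.InnerRegular := by
    classical
    refine Finset.sum_induction _ (fun μ : Measure X => IsFiniteMeasure μ ∧ μ.InnerRegular)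
      (fun μ μ' h h' => ?_) ⟨inferInstance, inferInstance⟩
      fun φ _ => ⟨inferInstance, inferInstance⟩
    obtain ⟨h1, h2⟩ := h
    obtain ⟨h3, h4⟩ := h'
    exact ⟨inferInstance, inferInstance⟩
  obtain ⟨h1, h2⟩ := hν
  choose f hf using fun n : ℕ => exists_norm_spectralVector_sub_le ρ hS ν
    (Nat.one_div_pos_of_nat (α := ℝ) (n := n))
  refine ⟨f, fun φ hφ => ?_⟩
  rw [tendsto_iff_norm_sub_tendsto_zero]
  refine squeeze_zero (fun _ => norm_nonneg _) (fun n => ?_)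
    tendsto_one_div_add_atTop_nhds_zero_nat
  rw [norm_sub_rev]
  exact hf n φ (Finset.single_le_sum (f := scalarMeasure ρ) (fun _ _ => Measure.zero_le _) hφ)

/-- Additivity in `φ` is not evident from the definition, in which the measure `μ_φ` varies with `φ`;
it is inherited from the operators `ρ(f)`. -/
theorem spectralVector_add {S : Set X} (hS : MeasurableSet S) (φ ψ : H) :
    spectralVector ρ hS (φ + ψ) = spectralVector ρ hS φ + spectralVector ρ hS ψ := by
  classical
  obtain ⟨f, hf⟩ := exists_tendsto_spectralVector ρ hS {φ, ψ, φ + ψ}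
  refine tendsto_nhds_unique (hf _ (by simp)) ?_
  simpa only [map_add] using (hf φ (by simp)).add (hf ψ (by simp))

theorem spectralVector_smul {S : Set X} (hS : MeasurableSet S) (c : ℂ) (φ : H) :
    spectralVector ρ hS (c • φ) = c • spectralVector ρ hS φ := by
  classical
  obtain ⟨f, hf⟩ := exists_tendsto_spectralVector ρ hS {φ, c • φ}
  refine tendsto_nhds_unique (hf _ (by simp)) ?_
  simpa only [map_smul] using (hf φ (by simp)).const_smul c

theorem inner_spectralVector_left {S : Set X} (hS : MeasurableSet S) (φ ψ : H) :
    ⟪spectralVector ρ hS φ, ψ⟫_ℂ = ⟪φ, spectralVector ρ hS ψ⟫_ℂ := by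
  classical
  obtain ⟨f, hf⟩ := exists_tendsto_spectralVector ρ hS {φ, ψ}
  refine tendsto_nhds_unique ((hf φ (by simp)).inner tendsto_const_nhds) ?_
  simpa only [inner_map_map_star, ContinuousMap.star_complexify] using
    (tendsto_const_nhds (x := φ)).inner (hf ψ (by simp))

/-- The operator `φ ↦ E(S) φ`. -/
def spectralProj {S : Set X} (hS : MeasurableSet S) : H →L[ℂ] H :=
  LinearMap.mkContinuous
    { toFun := spectralVector ρ hS
      map_add' := spectralVector_add ρ hS
      map_smul' := spectralVector_smul ρ hS } 1
    fun φ => by rw [one_mul]; exact norm_spectralVector_le ρ hS φ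

theorem spectralProj_apply {S : Set X} (hS : MeasurableSet S) (φ : H) :
    spectralProj ρ hS φ = spectralVector ρ hS φ := rfl

theorem inner_spectralProj {S : Set X} (hS : MeasurableSet S) (φ : H) :
    ⟪φ, spectralProj ρ hS φ⟫_ℂ = (scalarMeasure ρ φ).real S := by
  rw [spectralProj_apply]
  have h := inner_spectralVector ρ MeasurableSet.univ hS φ
  rwa [spectralVector_univ, Set.univ_inter] at h

theorem spectralProj_mul {S T : Set X} (hS : MeasurableSet S) (hT : MeasurableSet T) :
    spectralProj ρ hS * spectralProj ρ hT = spectralProj ρ (hS.inter hT) := by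
  -- A complex operator is determined by its quadratic form.
  refine ContinuousLinearMap.coe_injective ((ext_inner_map _ _).1 fun φ => ?_)
  rw [← inner_conj_symm]
  conv_rhs => rw [← inner_conj_symm]
  congr 1
  simp only [ContinuousLinearMap.coe_coe, mul_apply_eq_comp]
  rw [inner_spectralProj, spectralProj_apply, ← inner_spectralVector_left, spectralProj_apply,
    inner_spectralVector]

theorem hasSum_spectralVector {S : ℕ → Set X} (hS : ∀ n, MeasurableSet (S n))
    (hd : Pairwise (Function.onFun Disjoint S)) (φ : H) :
    HasSum (fun n => spectralVector ρ (hS n) φ)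
      (spectralVector ρ (MeasurableSet.iUnion hS) φ) := by
  have hfin : ∀ s : Finset ℕ, ∑ n ∈ s, spectralVector ρ (hS n) φ =
      spectralVector ρ (s.measurableSet_biUnion fun n _ => hS n) φ := by
    classical
    intro s
    induction s using Finset.induction_on with
    | empty =>
      rw [Finset.sum_empty, eq_comm, ← norm_eq_zero, ← sq_eq_zero_iff, norm_spectralVector_sq]
      simp
    | insert a s ha ih =>
      rw [Finset.sum_insert ha, ih, ← spectralVector_union]
      · congr 1
        simp
      · refine Set.disjoint_iUnion₂_right.2 fun n hn => hd ?_
        rintro rfl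
        exact ha hn
  -- The remainder is `E` of the union of the sets left out, and its norm is a scalar measure.
  have hdiff : ∀ s : Finset ℕ, ‖∑ n ∈ s, spectralVector ρ (hS n) φ -
      spectralVector ρ (MeasurableSet.iUnion hS) φ‖ ^ 2 =
      (scalarMeasure ρ φ).real (⋃ n, S n) - ∑ n ∈ s, (scalarMeasure ρ φ).real (S n) := by
    intro s
    have hm := s.measurableSet_biUnion fun n _ => hS n
    have hsub : (⋃ n ∈ s, S n) ⊆ ⋃ n, S n :=
      Set.iUnion₂_subset fun n _ => Set.subset_iUnion S n
    have h1 := spectralVector_union ρ hm ((MeasurableSet.iUnion hS).diff hm)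
      Set.disjoint_sdiff_right φ
    have h2 : spectralVector ρ (hm.union ((MeasurableSet.iUnion hS).diff hm)) φ =
        spectralVector ρ (MeasurableSet.iUnion hS) φ := by
      congr 1
      exact Set.union_sdiff_cancel hsub
    rw [hfin, ← h2, h1, norm_sub_rev, add_sub_cancel_left, norm_spectralVector_sq,
      measureReal_sdiff hsub hm, measureReal_biUnion_finset (fun i _ j _ h => hd h)
      fun n _ => hS n]
  have hμ : HasSum (fun n => (scalarMeasure ρ φ).real (S n))
      ((scalarMeasure ρ φ).real (⋃ n, S n)) := by
    have h := measure_iUnion (μ := scalarMeasure ρ φ) hd hS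
    rw [measureReal_def, h, ENNReal.tsum_toReal_eq fun n => measure_ne_top _ _]
    exact (ENNReal.summable_toReal (h ▸ measure_ne_top _ _)).hasSum
  rw [HasSum, tendsto_iff_norm_sub_tendsto_zero]
  have h0 := hμ.const_sub ((scalarMeasure ρ φ).real (⋃ n, S n))
  rw [sub_self] at h0
  have h1 := (Real.continuous_sqrt.tendsto 0).comp h0
  rw [Real.sqrt_zero] at h1
  refine h1.congr fun s => ?_
  rw [Function.comp_apply, ← hdiff, Real.sqrt_sq (norm_nonneg _)]

open Classical in
/-- The projection-valued measure of a representation of `C(X)`. -/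
def spectralMeasure : ProjectionValuedMeasure X H where
  toFun S := if hS : MeasurableSet S then spectralProj ρ hS else 0
  not_measurable S hS := dif_neg hS
  isStarProjection S hS := by
    rw [dif_pos hS]
    refine ⟨?_, ?_⟩
    · have h := spectralProj_mul ρ hS hS
      simp only [Set.inter_self] at h
      exact h
    · rw [ContinuousLinearMap.isSelfAdjoint_iff_isSymmetric]
      exact inner_spectralVector_left ρ hS
  empty := by
    rw [dif_pos MeasurableSet.empty]
    ext φ
    rw [spectralProj_apply, zero_apply, ← norm_eq_zero, ← sq_eq_zero_iff,
      norm_spectralVector_sq, measureReal_empty]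
  univ := by
    rw [dif_pos MeasurableSet.univ]
    ext φ
    exact spectralVector_univ ρ φ
  inter S T hS hT := by
    rw [dif_pos hS, dif_pos hT, dif_pos (hS.inter hT), spectralProj_mul]
  hasSum_iUnion S hS hd φ := by
    simp only [dif_pos (hS _), dif_pos (MeasurableSet.iUnion hS), spectralProj_apply]
    exact hasSum_spectralVector ρ hS hd φ

theorem vectorMeasure_spectralMeasure (φ : H) :
    (spectralMeasure ρ).vectorMeasure φ = scalarMeasure ρ φ := by
  ext S hS
  rw [ProjectionValuedMeasure.vectorMeasure_apply _ _ _ hS]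
  simp only [spectralMeasure, dif_pos hS]
  rw [inner_spectralProj, Complex.ofReal_re, ofReal_measureReal]

/-- The spectral theorem for representations of `C(X)`, `X` compact Hausdorff:
`ρ(f) = ∫ f dE`. -/
theorem hasIntegral_spectralMeasure (f : C(X, ℂ)) :
    (spectralMeasure ρ).HasIntegral f (ρ f) := by
  intro φ
  rw [vectorMeasure_spectralMeasure]
  exact ⟨f.continuous.integrable_of_hasCompactSupport (HasCompactSupport.of_compactSpace _),
    (integral_scalarMeasure ρ φ f).symm⟩

end SpectralMeasure

/-! ### One-parameter groups of unitaries and the Bohr compactification -/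

/-- Every one-parameter group of unitaries, continuous or not, is the integral of the functions
`u_a` for a projection-valued measure on the Bohr compactification. -/
theorem exists_hasIntegral_u {H : Type*} [NormedAddCommGroup H] [InnerProductSpace ℂ H]
    [CompleteSpace H] (W : Multiplicative ℝ →* (H →L[ℂ] H))
    (hW : ∀ a, W a ∈ unitary (H →L[ℂ] H)) :
    ∃ E : ProjectionValuedMeasure BohrCompactification H, ∀ a : ℝ,
      E.HasIntegral (BohrCompactification.u a) (W (Multiplicative.ofAdd a)) := by
  obtain ⟨ρ, hρ⟩ := exists_starAlgHom_apExp W hW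
  let G : almostPeriodic ≃⋆ₐ[ℂ] C(BohrCompactification, ℂ) := gelfandStarTransform almostPeriodic
  let σ : C(BohrCompactification, ℂ) →⋆ₐ[ℂ] (H →L[ℂ] H) := ρ.comp (G.symm : _ →⋆ₐ[ℂ] _)
  refine ⟨spectralMeasure σ, fun a => ?_⟩
  have h : σ (BohrCompactification.u a) = W (Multiplicative.ofAdd a) :=
    (congrArg ρ (G.symm_apply_apply (apExp a))).trans (hρ a)
  rw [← h]
  exact hasIntegral_spectralMeasure σ _

theorem exists_hasIntegral_map {A H : Type*} [CStarAlgebra A] [NormedAddCommGroup H]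
    [InnerProductSpace ℂ H] [CompleteSpace H] (π : A →⋆ₐ[ℂ] (H →L[ℂ] H)) (U : ℝ → A)
    (hU : ∀ a, U a ∈ unitary A) (h0 : U 0 = 1) (hadd : ∀ a b, U (a + b) = U a * U b) :
    ∃ E : ProjectionValuedMeasure BohrCompactification H, ∀ a : ℝ,
      E.HasIntegral (BohrCompactification.u a) (π (U a)) :=
  exists_hasIntegral_u
    { toFun := fun a => π (U a.toAdd)
      map_one' := by rw [toAdd_one, h0, map_one]
      map_mul' := fun a b => by rw [toAdd_mul, hadd, map_mul] }
    fun a => Unitary.map_mem π (hU _)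

end

/-- For every irreducible representation `π` of the Weyl algebra there are projection-valued
measures `EQ`, `EP` on the Bohr compactification of `ℝ` such that `π (U a) = ∫ u_a dEQ` and
`π (V b) = ∫ u_b dEP` for all real `a` and `b`. -/
theorem mainTheorem3 {A : Type*} [CStarAlgebra A] (U V : ℝ → A) (hA : IsWeylAlgebra U V)
    {H : Type*} [NormedAddCommGroup H] [InnerProductSpace ℂ H] [CompleteSpace H]
    (π : A →⋆ₐ[ℂ] (H →L[ℂ] H)) (hπ : IsIrreducibleRep π) :
    ∃ EQ EP : ProjectionValuedMeasure BohrCompactification H,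
      (∀ a : ℝ, EQ.HasIntegral (BohrCompactification.u a) (π (U a))) ∧
      (∀ b : ℝ, EP.HasIntegral (BohrCompactification.u b) (π (V b))) := by
  obtain ⟨EQ, hQ⟩ := exists_hasIntegral_map π U hA.unitary_U hA.U_zero hA.U_add
  obtain ⟨EP, hP⟩ := exists_hasIntegral_map π V hA.unitary_V hA.V_zero hA.V_add
  exact ⟨EQ, EP, hQ, hP⟩
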